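/- Let $\mathbb{H}$ be the real quaternions with conjugation $\alpha\mapsto\alpha^*$ and the Euclidean norm. An $\mathbb{H}$-$B^*$-algebra is a (not necessarily unital) ring $A$ that is also a unital $\mathbb{H}$-bimodule on which $\mathbb{R}\subset\mathbb{H}$ acts identically from the left and from the right, together with an additive involution $^*$ satisfying $(ab)^*=b^*a^*$, and a complete norm, such that for all $a,b\in A$ and $\gamma\in\mathbb{H}$ $$(\gamma a)b=\gamma(ab),\quad (a\gamma)b=a(\gamma b),\quad (ab)\gamma=a(b\gamma),\quad (\gamma a)^*=a^*\gamma^*,\quad (a\gamma)^*=\gamma^*a^*,$$ $$\|\gamma a\|\le\|\gamma\|\,\|a\|,\quad \|a\gamma\|\le\|a\|\,\|\gamma\|,\quad \|ab\|\le\|a\|\,\|b\|,\quad \|a^*a\|=\|a\|^2 .$$ An isomorphism of $\mathbb{H}$-$B^*$-algebras is an isometric bijection preserving sums, products, involutions and the left and right multiplications by quaternions. For a locally compact Hausdorff space $\Omega$, $C_0(\Omega;\mathbb{H})$ is the $\mathbb{H}$-$B^*$-algebra of continuous functions $\Omega\to\mathbb{H}$ vanishing at infinity, with pointwise operations and the supremum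 norm. **Theorem (Gelfand theorem).** Let $A$ be an $\mathbb{H}$-$B^*$-algebra. Then $A$ is isomorphic, as an $\mathbb{H}$-$B^*$-algebra, to $C_0(\Omega;\mathbb{H})$ for some locally compact Hausdorff space $\Omega$ if and only if every element of $A$ is normal, i.e. $a^*a=aa^*$ for all $a\in A$. -/

import Mathlib

open scoped Quaternion ZeroAtInfty RightActions

universe u

/-- A quaternion `B⋆`-algebra. The left multiplication by `γ` is written `γ • a`, and the right
multiplication by `γ` is written `a <• γ` (a left action of the opposite ring `ℍᵐᵒᵖ`).
The parameters and parent classes say that `A` is a complete normed (not necessarily unital) ring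
with `‖a * b‖ ≤ ‖a‖ * ‖b‖`, an additive, antimultiplicative, involutive `star` and
`‖a‖ ^ 2 = ‖star a * a‖`, and that `A` carries unital left and right `ℍ`-module structures. -/
class QuaternionBStarAlgebra (A : Type*) [NonUnitalNormedRing A] [StarRing A]
    [Module ℍ A] [Module ℍᵐᵒᵖ A] : Prop extends CompleteSpace A, CStarRing A where
  /-- `A` is a bimodule. -/
  smul_right_smul : ∀ (α : ℍ) (a : A) (β : ℍ), α • (a <• β) = (α • a) <• β
  /-- The centre `ℝ` of `ℍ` acts in the same way on both sides. -/
  real_smul_eq : ∀ (r : ℝ) (a : A), (r : ℍ) • a = a <• (r : ℍ)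
  /-- `(γ a) b = γ (a b)` -/
  left_smul_mul : ∀ (γ : ℍ) (a b : A), (γ • a) * b = γ • (a * b)
  /-- `(a γ) b = a (γ b)` -/
  right_smul_mul : ∀ (γ : ℍ) (a b : A), (a <• γ) * b = a * (γ • b)
  /-- `(a b) γ = a (b γ)` -/
  mul_right_smul : ∀ (γ : ℍ) (a b : A), (a * b) <• γ = a * (b <• γ)
  /-- `(α b)^* = b^* α^*` -/
  star_left_smul : ∀ (α : ℍ) (b : A), star (α • b) = star b <• star α
  /-- `(b α)^* = α^* b^*` -/
  star_right_smul : ∀ (α : ℍ) (b : A), star (b <• α) = star α • star b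
  /-- The norm is a norm of left `ℍ`-modules. -/
  norm_left_smul_le : ∀ (α : ℍ) (a : A), ‖α • a‖ ≤ ‖α‖ * ‖a‖
  /-- The norm is a norm of right `ℍ`-modules. -/
  norm_right_smul_le : ∀ (a : A) (α : ℍ), ‖a <• α‖ ≤ ‖a‖ * ‖α‖

/-- An isomorphism of quaternion `B⋆`-algebras: a bijection preserving sums, products, the
involution, both quaternion scalar multiplications and the norm. -/
structure QuaternionBStarEquiv (A B : Type*)
    [NonUnitalNormedRing A] [StarRing A] [Module ℍ A] [Module ℍᵐᵒᵖ A] [QuaternionBStarAlgebra A]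
    [NonUnitalNormedRing B] [StarRing B] [Module ℍ B] [Module ℍᵐᵒᵖ B] [QuaternionBStarAlgebra B]
    extends A ≃⋆+* B where
  map_left_smul : ∀ (α : ℍ) (a : A), toFun (α • a) = α • toFun a
  map_right_smul : ∀ (a : A) (α : ℍ), toFun (a <• α) = toFun a <• α
  norm_map : ∀ a : A, ‖toFun a‖ = ‖a‖

/-- `C₀(Ω, ℍ)`, with the pointwise operations and the supremum norm, is a quaternion
`B⋆`-algebra. -/
instance QuaternionBStarAlgebra.instZeroAtInfty
    (Ω : Type*) [TopologicalSpace Ω] : QuaternionBStarAlgebra C₀(Ω, ℍ) where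
  smul_right_smul α a β := by
    ext1 x
    exact (mul_assoc α (a x) β).symm
  real_smul_eq r a := by
    ext1 x
    exact Quaternion.coe_commutes r (a x)
  left_smul_mul γ a b := by
    ext1 x
    exact mul_assoc γ (a x) (b x)
  right_smul_mul γ a b := by
    ext1 x
    exact mul_assoc (a x) γ (b x)
  mul_right_smul γ a b := by
    ext1 x
    exact mul_assoc (a x) (b x) γ
  star_left_smul α b := by
    ext1 x
    exact star_mul α (b x)
  star_right_smul α b := by
    ext1 x
    exact star_mul (b x) α
  norm_left_smul_le α a := by
    rw [← ZeroAtInftyContinuousMap.norm_toBCF_eq_norm]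
    refine (BoundedContinuousFunction.norm_le (by positivity)).2 fun x => ?_
    refine (norm_mul_le α (a x)).trans ?_
    gcongr
    exact a.toBCF.norm_coe_le_norm x
  norm_right_smul_le a α := by
    rw [← ZeroAtInftyContinuousMap.norm_toBCF_eq_norm]
    refine (BoundedContinuousFunction.norm_le (by positivity)).2 fun x => ?_
    refine (norm_mul_le (a x) α).trans ?_
    gcongr
    exact a.toBCF.norm_coe_le_norm x

/-! Averaging `e a e*` over `e = 1, i, j, k` projects `A` onto the elements commuting with `ℍ` and
writes every element as a sum of products `a q` with `a` in this commutant
(`average_decomposition`). If all elements are normal, polarization at `a i`, `b j` forces the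
commutant to be self-adjoint. It is then exactly the self-adjoint part of `A`
(`mem_quaternionCommutant_iff_star_eq`).

The commutant is only a real algebra, so Gelfand duality is applied to the larger commutant of `ℂ`,
a complex `C⋆`-algebra, commutative by polarization. Its self-adjoint elements correspond to the
real functions in `C₀(Ω, ℂ)`, which form the commutant of `ℍ` in `C₀(Ω, ℍ)`. This map extends to `A`
by `a q ↦ ψ(a) q`. It is isometric because `‖x‖² = ‖x* x‖` and `x* x` lies in the commutant.
Conversely, normality holds pointwise in `ℍ`. -/

/-! ### Gelfand duality without a unit -/

section GelfandNonUnital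

open Filter Topology

/-- In a compact Hausdorff space with a point `p` removed, points near infinity approach `p`. -/
theorem tendsto_subtype_val_cocompact_nhds {X : Type*} [TopologicalSpace X] [CompactSpace X]
    (p : X) : Tendsto (Subtype.val : {x : X // x ≠ p} → X) (cocompact _) (𝓝 p) := by
  refine (nhds_basis_opens p).tendsto_right_iff.2 fun U ⟨hp, hU⟩ => ?_
  refine mem_cocompact.2 ⟨Subtype.val ⁻¹' Uᶜ, ?_, fun x hx => not_not.1 hx⟩
  refine IsInducing.subtypeVal.isCompact_preimage' hU.isClosed_compl.isCompact fun x hx => ?_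
  exact ⟨⟨x, fun h => hx (h ▸ hp)⟩, rfl⟩

/-- A function vanishing at infinity off a point of a Hausdorff space extends continuously by zero
to that point. -/
theorem ZeroAtInftyContinuousMap.exists_continuousMap_extension {X : Type*} [TopologicalSpace X]
    [T2Space X] {β : Type*} [TopologicalSpace β] [Zero β] (p : X)
    (g : C₀({x : X // x ≠ p}, β)) :
    ∃ f : C(X, β), f p = 0 ∧ ∀ x : {x : X // x ≠ p}, f x = g x := by
  classical
  let f : X → β := fun x => if h : x ≠ p then g ⟨x, h⟩ else 0
  have hfp : f p = 0 := by simp [f]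
  have hf : ∀ x : {x : X // x ≠ p}, f x = g x := fun x => by simp [f, x.2]
  refine ⟨⟨f, continuous_iff_continuousAt.2 fun x => ?_⟩, hfp, hf⟩
  by_cases hx : x = p
  · subst hx
    rw [ContinuousAt, hfp]
    intro V hV
    rw [mem_map]
    obtain ⟨K, hK, hKV⟩ := mem_cocompact.1 (g.zero_at_infty' hV)
    have hc : IsClosed (Subtype.val '' K) := (hK.image continuous_subtype_val).isClosed
    have hxK : x ∉ Subtype.val '' K := fun ⟨y, _, hy⟩ => y.2 hy
    filter_upwards [hc.isOpen_compl.mem_nhds hxK] with y hy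
    by_cases hyx : y = x
    · subst hyx
      exact Set.mem_preimage.2 (hfp.symm ▸ mem_of_mem_nhds hV)
    · have hyK : (⟨y, hyx⟩ : {z : X // z ≠ x}) ∉ K := fun h => hy ⟨_, h, rfl⟩
      exact Set.mem_preimage.2 ((hf ⟨y, hyx⟩).symm ▸ hKV hyK)
  · have ho : IsOpenEmbedding (Subtype.val : {x : X // x ≠ p} → X) :=
      isOpen_ne.isOpenEmbedding_subtypeVal
    refine (ho.continuousAt_iff (x := ⟨x, hx⟩)).1 ?_
    rw [show f ∘ Subtype.val = g from funext hf]
    exact g.continuous.continuousAt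

open Unitization in
/-- **Gelfand duality** for commutative, not necessarily unital, `C⋆`-algebras. -/
theorem NonUnitalCommCStarAlgebra.exists_starAlgEquiv_zeroAtInfty (B : Type u)
    [NonUnitalCommCStarAlgebra B] :
    ∃ (Ω : Type u) (_ : TopologicalSpace Ω) (_ : LocallyCompactSpace Ω) (_ : T2Space Ω),
      Nonempty (B ≃⋆ₐ[ℂ] C₀(Ω, ℂ)) := by
  let X := WeakDual.characterSpace ℂ (Unitization ℂ B)
  let G : Unitization ℂ B ≃⋆ₐ[ℂ] C(X, ℂ) := gelfandStarTransform (Unitization ℂ B)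
  -- The character that kills `B`; removing it leaves `Ω`, and `B` becomes the functions vanishing
  -- there.
  let p : X := WeakDual.CharacterSpace.equivAlgHom.symm (fstHom ℂ B)
  have hp : ∀ u, G u p = u.fst := fun u => rfl
  let φ : B →⋆ₙₐ[ℂ] C₀({x : X // x ≠ p}, ℂ) :=
    { toFun := fun b =>
        { toFun := fun x => G b x
          continuous_toFun := (G b).continuous.comp continuous_subtype_val
          zero_at_infty' := by
            have h := ((G b).continuous.tendsto p).comp (tendsto_subtype_val_cocompact_nhds p)
            rwa [hp, fst_inr] at h }
      map_smul' := fun z b => by ext x; simp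
      map_zero' := by ext x; simp
      map_add' := fun a b => by ext x; simp
      map_mul' := fun a b => by ext x; simp
      map_star' := fun a => by
        ext x
        have h : G ((star a : B) : Unitization ℂ B) = star (G a) := by rw [inr_star, map_star]
        exact DFunLike.congr_fun h x.1 }
  have hφ : ∀ b x, φ b x = G b x := fun b x => rfl
  refine ⟨{x : X // x ≠ p}, inferInstance, isOpen_ne.locallyCompactSpace, inferInstance,
    ⟨StarAlgEquiv.ofBijective φ ⟨?_, fun g => ?_⟩⟩⟩
  · refine (injective_iff_map_eq_zero φ).2 fun b hb => ?_
    refine inr_injective (R := ℂ) (EquivLike.injective G ?_)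
    ext x
    by_cases hx : x = p
    · rw [hx, hp, hp, fst_inr, fst_inr]
    · have h := DFunLike.congr_fun hb ⟨x, hx⟩
      rw [hφ] at h
      simpa using! h
  · obtain ⟨f, hfp, hf⟩ := g.exists_continuousMap_extension p
    obtain ⟨u, rfl⟩ := EquivLike.surjective G f
    rw [hp] at hfp
    -- The scalar part of `u` is its value at `p`, which is zero, so `u` comes from `B`.
    refine ⟨u.snd, ?_⟩
    ext x
    rw [hφ, ← hf x]
    congr 2
    ext <;> simp [hfp]

end GelfandNonUnital

/-! ### Averaging over the quaternion units -/

namespace QuaternionBStarAlgebra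

open MulOpposite

variable {A : Type*} [NonUnitalNormedRing A] [StarRing A] [Module ℍ A] [Module ℍᵐᵒᵖ A]
  [QuaternionBStarAlgebra A]

instance : SMulCommClass ℍ ℍᵐᵒᵖ A where
  smul_comm p q a := smul_right_smul p a q.unop

/-- The imaginary unit `i`. -/
def qi : ℍ := ⟨0, 1, 0, 0⟩

/-- The imaginary unit `j`. -/
def qj : ℍ := ⟨0, 0, 1, 0⟩

/-- The imaginary unit `k`. -/
def qk : ℍ := ⟨0, 0, 0, 1⟩

@[simp] theorem qi_re : qi.re = 0 := rfl
@[simp] theorem qi_imI : qi.imI = 1 := rfl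
@[simp] theorem qi_imJ : qi.imJ = 0 := rfl
@[simp] theorem qi_imK : qi.imK = 0 := rfl
@[simp] theorem qj_re : qj.re = 0 := rfl
@[simp] theorem qj_imI : qj.imI = 0 := rfl
@[simp] theorem qj_imJ : qj.imJ = 1 := rfl
@[simp] theorem qj_imK : qj.imK = 0 := rfl
@[simp] theorem qk_re : qk.re = 0 := rfl
@[simp] theorem qk_imI : qk.imI = 0 := rfl
@[simp] theorem qk_imJ : qk.imJ = 0 := rfl
@[simp] theorem qk_imK : qk.imK = 1 := rfl

theorem qi_mul_qi : qi * qi = -1 := by ext <;> simp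
theorem qj_mul_qj : qj * qj = -1 := by ext <;> simp
theorem qk_mul_qk : qk * qk = -1 := by ext <;> simp
theorem qi_mul_qj : qi * qj = qk := by ext <;> simp
theorem qj_mul_qi : qj * qi = -qk := by ext <;> simp
theorem qj_mul_qk : qj * qk = qi := by ext <;> simp
theorem qk_mul_qj : qk * qj = -qi := by ext <;> simp
theorem qk_mul_qi : qk * qi = qj := by ext <;> simp
theorem qi_mul_qk : qi * qk = -qj := by ext <;> simp
theorem star_qi : star qi = -qi := by ext <;> simp
theorem star_qj : star qj = -qj := by ext <;> simp

theorem eq_re_add_im_units (q : ℍ) :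
    q = (q.re : ℍ) + (q.imI : ℍ) * qi + (q.imJ : ℍ) * qj + (q.imK : ℍ) * qk := by
  ext <;> simp

variable (A) in
/-- The elements commuting with all quaternions. -/
def quaternionCommutant : NonUnitalSubring A where
  carrier := {a | ∀ q : ℍ, q • a = a <• q}
  zero_mem' q := by simp
  add_mem' {a b} ha hb q := by rw [smul_add, smul_add, ha, hb]
  neg_mem' {a} ha q := by rw [smul_neg, smul_neg, ha]
  mul_mem' {a b} ha hb q := by
    rw [← left_smul_mul, ha, right_smul_mul, hb, mul_right_smul]

theorem star_mem_quaternionCommutant {a : A} (ha : a ∈ quaternionCommutant A) :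
    star a ∈ quaternionCommutant A := fun q => by
  have h := congrArg star (ha (star q))
  rw [star_left_smul, star_right_smul, star_star] at h
  exact h.symm

theorem mem_quaternionCommutant_of_commute {a : A} (hi : qi • a = a <• qi)
    (hj : qj • a = a <• qj) : a ∈ quaternionCommutant A := fun q => by
  have hk : qk • a = a <• qk := by
    rw [← qi_mul_qj, mul_smul, hj, smul_right_smul, hi, op_mul, mul_smul]
  have h : ∀ (r : ℝ) (u : ℍ), u • a = a <• u → ((r : ℍ) * u) • a = a <• ((r : ℍ) * u) := by
    intro r u hu
    rw [mul_smul, hu, smul_right_smul, real_smul_eq, op_mul, mul_smul]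
  rw [eq_re_add_im_units q]
  simp only [add_smul, op_add]
  rw [real_smul_eq, h _ _ hi, h _ _ hj, h _ _ hk]

/-- The sum `∑ e • a <• star e` over `e = 1, i, j, k`. -/
noncomputable def conjSum : A →+ A where
  toFun a := a - qi • (a <• qi) - qj • (a <• qj) - qk • (a <• qk)
  map_zero' := by simp
  map_add' a b := by
    simp only [smul_add]
    abel

theorem conjSum_apply (a : A) :
    conjSum a = a - qi • (a <• qi) - qj • (a <• qj) - qk • (a <• qk) := rfl

/-- For `u = i, j`, left multiplication permutes the units up to sign, so `u ∑ e a e* = (∑ (ue) a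
(ue)*) u`. -/
theorem conjSum_mem (a : A) : conjSum a ∈ quaternionCommutant A := by
  apply mem_quaternionCommutant_of_commute <;>
  · simp only [conjSum_apply, smul_sub, ← smul_right_smul, smul_smul, ← op_mul, qi_mul_qi,
      qj_mul_qj, qk_mul_qk, qi_mul_qj, qj_mul_qi, qj_mul_qk, qk_mul_qj, qk_mul_qi, qi_mul_qk,
      neg_smul, smul_neg, op_neg, one_smul, op_one]
    abel

/-- The left side is `∑ e a (∑ f* e* f)` over units `e`, `f`. The inner sum is `4 Re e`, so only `e
= 1` survives. -/
theorem conjSum_decomposition (a : A) :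
    conjSum a - conjSum (a <• qi) <• qi - conjSum (a <• qj) <• qj - conjSum (a <• qk) <• qk
      = 4 • a := by
  simp only [conjSum_apply, smul_sub, ← smul_right_smul, smul_smul, ← op_mul, qi_mul_qi,
    qj_mul_qj, qk_mul_qk, qi_mul_qj, qj_mul_qi, qj_mul_qk, qk_mul_qj, qk_mul_qi, qi_mul_qk,
    neg_smul, smul_neg, op_neg, one_smul, op_one]
  abel

theorem smul_real_mem {a : A} (r : ℝ) (ha : a ∈ quaternionCommutant A) :
    (r : ℍ) • a ∈ quaternionCommutant A := fun q => by
  rw [← smul_right_smul, ← ha, smul_smul, smul_smul, Quaternion.coe_commutes]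

/-- The average of `e • a <• star e` over `e = 1, i, j, k`. -/
noncomputable def average : A →+ A :=
  (DistribSMul.toAddMonoidHom A (((1 / 4 : ℝ) : ℍ))).comp conjSum

theorem average_apply (a : A) : average a = ((1 / 4 : ℝ) : ℍ) • conjSum a := rfl

theorem average_mem (a : A) : average a ∈ quaternionCommutant A :=
  smul_real_mem _ (conjSum_mem a)

theorem average_decomposition (a : A) :
    average a - average (a <• qi) <• qi - average (a <• qj) <• qj - average (a <• qk) <• qk
      = a := by
  simp only [average_apply, ← smul_right_smul, ← smul_sub, conjSum_decomposition]
  rw [← Nat.cast_smul_eq_nsmul ℍ, smul_smul]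
  have h : ((1 / 4 : ℝ) : ℍ) * ((4 : ℕ) : ℍ) = 1 := by
    rw [← Quaternion.coe_natCast, ← Quaternion.coe_mul]
    norm_num
  rw [h, one_smul]

theorem average_right_smul {a : A} (ha : a ∈ quaternionCommutant A) (q : ℍ) :
    average (a <• q) = (q.re : ℍ) • a := by
  have hq : q - qi * q * qi - qj * q * qj - qk * q * qk = ((4 * q.re : ℝ) : ℍ) := by
    ext <;> simp <;> ring
  have hu : ∀ u : ℍ, u • (a <• q <• u) = a <• (u * q * u) := fun u => by
    rw [smul_right_smul, smul_right_smul, ha, op_mul, op_mul, mul_smul, mul_smul]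
  have h : conjSum (a <• q) = ((4 * q.re : ℝ) : ℍ) • a := by
    rw [conjSum_apply, hu, hu, hu, ← sub_smul, ← sub_smul, ← sub_smul, ← op_sub, ← op_sub,
      ← op_sub, hq, ha]
  rw [average_apply, h, smul_smul, ← Quaternion.coe_mul]
  congr 2
  ring

theorem induction_right_smul {p : A → Prop} (add : ∀ x y, p x → p y → p (x + y))
    (smul : ∀ a ∈ quaternionCommutant A, ∀ q : ℍ, p (a <• q)) (x : A) : p x := by
  rw [← average_decomposition x]
  simp only [sub_eq_add_neg, ← neg_smul, ← op_neg]
  refine add _ _ (add _ _ (add _ _ ?_ ?_) ?_) ?_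
  · simpa using smul _ (average_mem x) 1
  all_goals exact smul _ (average_mem _) _

end QuaternionBStarAlgebra

/-! ### Polarized normality -/

/-- Polarization of the normality condition. -/
theorem star_mul_add_star_mul {A : Type*} [NonUnitalRing A] [StarRing A]
    (h : ∀ a : A, IsStarNormal a) (a b : A) :
    star a * b + star b * a = a * star b + b * star a := by
  have h1 := (h (a + b)).star_comm_self.eq
  rw [star_add, add_mul, mul_add, mul_add, add_mul, mul_add, mul_add,
    (h a).star_comm_self.eq, (h b).star_comm_self.eq] at h1
  rw [← sub_eq_zero] at h1 ⊢
  rw [← h1]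
  abel

/-- A complex `C⋆`-algebra all of whose elements are normal is commutative. -/
theorem NonUnitalCStarAlgebra.mul_comm_of_forall_isStarNormal {B : Type*}
    [NonUnitalCStarAlgebra B] (h : ∀ a : B, IsStarNormal a) (a b : B) : a * b = b * a := by
  have h1 := star_mul_add_star_mul h (star a) b
  -- Replacing `b` by `I • b` flips the relative sign of the terms in `star b`, so a combination
  -- with `h1` eliminates them.
  have h2 := star_mul_add_star_mul h (star a) (Complex.I • b)
  simp only [star_smul, smul_mul_assoc, mul_smul_comm, star_star, RCLike.star_def, Complex.conj_I]
    at h1 h2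
  have h3 : (Complex.I * Complex.I) • (a * b) = (Complex.I * Complex.I) • (b * a) := by
    linear_combination (norm := module) (Complex.I / 2) • h2 + (Complex.I * Complex.I / 2) • h1
  simpa using h3

/-! ### The commutant of `ℂ` and consequences of normality -/

namespace QuaternionBStarAlgebra

open MulOpposite

variable {A : Type*} [NonUnitalNormedRing A] [StarRing A] [Module ℍ A] [Module ℍᵐᵒᵖ A]
  [QuaternionBStarAlgebra A]

section ComplexCommutant

variable (A) in
/-- The elements commuting with the complex numbers `ℂ ⊆ ℍ`. -/
def complexCommutant : NonUnitalSubring A where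
  carrier := {a | ∀ z : ℂ, (z : ℍ) • a = a <• (z : ℍ)}
  zero_mem' q := by simp
  add_mem' {a b} ha hb q := by rw [smul_add, smul_add, ha, hb]
  neg_mem' {a} ha q := by rw [smul_neg, smul_neg, ha]
  mul_mem' {a b} ha hb q := by
    rw [← left_smul_mul, ha, right_smul_mul, hb, mul_right_smul]

theorem quaternionCommutant_le_complexCommutant :
    quaternionCommutant A ≤ complexCommutant A := fun _ ha z => ha z

theorem star_coeComplex (z : ℂ) : star (z : ℍ) = ((star z : ℂ) : ℍ) := by
  ext <;> simp

theorem norm_coeComplex (z : ℂ) : ‖(z : ℍ)‖ = ‖z‖ := by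
  rw [← sq_eq_sq₀ (norm_nonneg _) (norm_nonneg _), sq, ← Quaternion.normSq_eq_norm_mul_self,
    Quaternion.normSq_def', ← Complex.normSq_eq_norm_sq, Complex.normSq_apply]
  simp
  ring

theorem star_mem_complexCommutant {a : A} (ha : a ∈ complexCommutant A) :
    star a ∈ complexCommutant A := fun z => by
  have h := congrArg star (ha (star z))
  rw [star_left_smul, star_right_smul, star_coeComplex, star_star] at h
  exact h.symm

theorem coeComplex_smul_mem {a : A} (ha : a ∈ complexCommutant A) (z : ℂ) :
    (z : ℍ) • a ∈ complexCommutant A := fun w => by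
  rw [← smul_right_smul, ← ha w, smul_smul, smul_smul, ← Quaternion.coeComplex_mul,
    ← Quaternion.coeComplex_mul, mul_comm]

variable (A) in
theorem isClosed_complexCommutant : IsClosed (complexCommutant A : Set A) := by
  have hl (q : ℍ) : Continuous fun a : A => q • a :=
    AddMonoidHomClass.continuous_of_bound (DistribSMul.toAddMonoidHom A q) ‖q‖ (norm_left_smul_le q)
  have hr (q : ℍ) : Continuous fun a : A => a <• q :=
    AddMonoidHomClass.continuous_of_bound (DistribSMul.toAddMonoidHom A (op q)) ‖q‖ fun a =>
      (norm_right_smul_le a q).trans_eq (mul_comm _ _)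
  rw [show (complexCommutant A : Set A) = ⋂ z : ℂ, {a | (z : ℍ) • a = a <• (z : ℍ)} by
    ext
    rw [Set.mem_iInter]
    rfl]
  exact isClosed_iInter fun z => isClosed_eq (hl _) (hr _)

instance : StarRing (complexCommutant A) where
  star a := ⟨star a.1, star_mem_complexCommutant a.2⟩
  star_involutive a := Subtype.ext (star_star a.1)
  star_mul a b := Subtype.ext (star_mul a.1 b.1)
  star_add a b := Subtype.ext (star_add a.1 b.1)

noncomputable instance : Module ℂ (complexCommutant A) where
  smul z a := ⟨(z : ℍ) • a.1, coeComplex_smul_mem a.2 z⟩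
  one_smul a := Subtype.ext (by
    change ((1 : ℂ) : ℍ) • a.1 = a.1
    rw [Quaternion.coeComplex_one, one_smul])
  mul_smul z w a := Subtype.ext (by
    change ((z * w : ℂ) : ℍ) • a.1 = (z : ℍ) • (w : ℍ) • a.1
    rw [Quaternion.coeComplex_mul, mul_smul])
  smul_zero z := Subtype.ext (smul_zero (z : ℍ))
  smul_add z a b := Subtype.ext (smul_add (z : ℍ) a.1 b.1)
  add_smul z w a := Subtype.ext (by
    change ((z + w : ℂ) : ℍ) • a.1 = (z : ℍ) • a.1 + (w : ℍ) • a.1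
    rw [Quaternion.coeComplex_add, add_smul])
  zero_smul a := Subtype.ext (by
    change ((0 : ℂ) : ℍ) • a.1 = 0
    rw [Quaternion.coeComplex_zero, zero_smul])

theorem coe_complex_smul (z : ℂ) (a : complexCommutant A) : (z • a).1 = (z : ℍ) • a.1 := rfl

noncomputable instance : NonUnitalNormedRing (complexCommutant A) :=
  NonUnitalNormedRing.induced _ A (NonUnitalSubringClass.subtype (complexCommutant A)) Subtype.val_injective

theorem norm_coe_complexCommutant (a : complexCommutant A) : ‖a.1‖ = ‖a‖ := rfl

/-- Agreement of the left and right actions of `ℂ` makes the product bilinear and the star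
conjugate-linear. -/
noncomputable instance : NonUnitalCStarAlgebra (complexCommutant A) where
  complete := (isClosed_complexCommutant A).completeSpace_coe.complete
  norm_mul_self_le a := CStarRing.norm_mul_self_le a.1
  norm_smul_le z a := (norm_left_smul_le (z : ℍ) a.1).trans_eq (by
    rw [norm_coeComplex, norm_coe_complexCommutant])
  smul_assoc z a b := Subtype.ext (left_smul_mul (z : ℍ) a.1 b.1)
  smul_comm z a b := Subtype.ext (by
    change (z : ℍ) • (a.1 * b.1) = a.1 * ((z : ℍ) • b.1)
    rw [← left_smul_mul, a.2, right_smul_mul])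
  star_smul z a := Subtype.ext (by
    change star ((z : ℍ) • a.1) = ((star z : ℂ) : ℍ) • star a.1
    rw [star_left_smul, star_coeComplex, star_mem_complexCommutant a.2])

theorem isStarNormal_complexCommutant (h : ∀ a : A, IsStarNormal a) (a : complexCommutant A) :
    IsStarNormal a :=
  ⟨Subtype.ext (h a.1).star_comm_self.eq⟩

end ComplexCommutant

theorem quaternion_two_ne_zero : (2 : ℍ) ≠ 0 := fun h =>
  two_ne_zero (α := ℝ) (congrArg (fun q : ℍ => q.re) h)

theorem mul_comm_of_mem_quaternionCommutant (h : ∀ a : A, IsStarNormal a) {a b : A}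
    (ha : a ∈ quaternionCommutant A) (hb : b ∈ quaternionCommutant A) : a * b = b * a :=
  congrArg Subtype.val (NonUnitalCStarAlgebra.mul_comm_of_forall_isStarNormal
    (isStarNormal_complexCommutant h) ⟨a, quaternionCommutant_le_complexCommutant ha⟩
    ⟨b, quaternionCommutant_le_complexCommutant hb⟩)

theorem right_smul_mul_right_smul {a b : A} (hb : b ∈ quaternionCommutant A) (p q : ℍ) :
    (a <• p) * (b <• q) = (a * b) <• (p * q) := by
  rw [← mul_right_smul, right_smul_mul, hb, ← mul_right_smul, op_mul, mul_smul]

theorem left_smul_right_smul {a : A} (ha : a ∈ quaternionCommutant A) (p q : ℍ) :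
    p • (a <• q) = a <• (p * q) := by
  rw [smul_right_smul, ha, op_mul, mul_smul]

/-- Since `i j = -j i`, polarized normality at `a i`, `b j` becomes `2 (a b* - a* b) k = 0` once
commutativity is used. -/
theorem mul_star_eq_star_mul (h : ∀ a : A, IsStarNormal a) {a b : A}
    (ha : a ∈ quaternionCommutant A) (hb : b ∈ quaternionCommutant A) :
    a * star b = star a * b := by
  have ha' := star_mem_quaternionCommutant ha
  have hb' := star_mem_quaternionCommutant hb
  have h1 := star_mul_add_star_mul h (a <• qi) (b <• qj)
  rw [star_right_smul, star_right_smul, ha', hb', right_smul_mul_right_smul hb,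
    right_smul_mul_right_smul ha, right_smul_mul_right_smul hb', right_smul_mul_right_smul ha',
    star_qi, star_qj, mul_neg, neg_mul, mul_neg, neg_mul, qi_mul_qj, qj_mul_qi, neg_neg,
    mul_comm_of_mem_quaternionCommutant h hb' ha, mul_comm_of_mem_quaternionCommutant h hb ha',
    op_neg, neg_smul, neg_smul, ← sub_eq_zero] at h1
  have h2 : (2 : ℍ) • ((a * star b - star a * b) <• qk) = 0 := by
    rw [two_smul, smul_sub, ← h1]
    abel
  have h3 := (smul_eq_zero.1 h2).resolve_left quaternion_two_ne_zero
  have h4 := congrArg (fun x => x <• (-qk)) h3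
  simp only [smul_zero, smul_smul, ← op_mul, mul_neg, qk_mul_qk, neg_neg, op_one, one_smul] at h4
  exact sub_eq_zero.1 h4

theorem star_eq_self_of_mem_quaternionCommutant (h : ∀ a : A, IsStarNormal a) {a : A}
    (ha : a ∈ quaternionCommutant A) : star a = a := by
  obtain ⟨s, hs⟩ : ∃ s, s = a - star a := ⟨_, rfl⟩
  have hsm : s ∈ quaternionCommutant A :=
    hs ▸ sub_mem ha (star_mem_quaternionCommutant ha)
  have hss : star s = -s := by rw [hs, star_sub, star_star, neg_sub]
  -- With a unit, `b = 1` would suffice. Here `b = s * s` gives `s³ = -s³`, and the `C⋆`-identity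
  -- then kills `s * s` and `s`.
  have h1 := mul_star_eq_star_mul h hsm (mul_mem hsm hsm)
  rw [star_mul, hss, neg_mul_neg, neg_mul, ← sub_eq_zero, sub_neg_eq_add, ← two_smul ℍ] at h1
  have h2 : s * (s * s) = 0 := (smul_eq_zero.1 h1).resolve_left quaternion_two_ne_zero
  have h3 : s * s = 0 := by
    rw [← CStarRing.star_mul_self_eq_zero_iff, star_mul, hss, neg_mul_neg, mul_assoc, h2, mul_zero]
  rw [eq_comm, ← sub_eq_zero, ← hs, ← CStarRing.star_mul_self_eq_zero_iff, hss, neg_mul, h3,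
    neg_zero]

theorem star_right_smul_eq (h : ∀ a : A, IsStarNormal a) {a : A}
    (ha : a ∈ quaternionCommutant A) (q : ℍ) : star (a <• q) = a <• star q := by
  rw [star_right_smul, star_eq_self_of_mem_quaternionCommutant h ha, ha]

theorem mem_quaternionCommutant_iff_star_eq (h : ∀ a : A, IsStarNormal a) {a : A} :
    a ∈ quaternionCommutant A ↔ star a = a := by
  refine ⟨star_eq_self_of_mem_quaternionCommutant h, fun ha => ?_⟩
  -- On `x = b q` the sum is `2 (Re q) b`; a self-adjoint `a` is half of `a + a*`.
  have h1 : ∀ x : A, x + star x ∈ quaternionCommutant A := by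
    refine induction_right_smul (fun x y hx hy => ?_) fun b hb q => ?_
    · rw [star_add, add_add_add_comm]
      exact add_mem hx hy
    · rw [star_right_smul_eq h hb, ← add_smul, ← op_add, Quaternion.self_add_star,
        ← hb, show (2 : ℍ) = ((2 : ℝ) : ℍ) from rfl, ← Quaternion.coe_mul]
      exact smul_real_mem _ hb
  have h2 := smul_real_mem (1 / 2) (h1 a)
  rw [ha, ← two_smul ℍ a, smul_smul] at h2
  have h3 : ((1 / 2 : ℝ) : ℍ) * 2 = 1 := by
    rw [show (2 : ℍ) = ((2 : ℝ) : ℍ) from rfl, ← Quaternion.coe_mul]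
    norm_num
  rwa [h3, one_smul] at h2

end QuaternionBStarAlgebra

/-! ### Extension from the commutant to the algebra -/

namespace QuaternionBStarAlgebra

open MulOpposite

section Extension

variable {A : Type*} [NonUnitalNormedRing A] [StarRing A] [Module ℍ A] [Module ℍᵐᵒᵖ A]
  [QuaternionBStarAlgebra A]
  {C : Type*} [NonUnitalNormedRing C] [StarRing C] [Module ℍ C] [Module ℍᵐᵒᵖ C]
  [QuaternionBStarAlgebra C]

/-- The extension of an additive map between quaternion commutants to the whole algebras. -/
noncomputable def commutantExtension (ψ : quaternionCommutant A →+ quaternionCommutant C) :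
    A →+ C :=
  let f : A →+ C := (AddSubgroupClass.subtype (quaternionCommutant C)).comp
    (ψ.comp (average.codRestrict (quaternionCommutant A) average_mem))
  let rA (q : ℍ) : A →+ A := DistribSMul.toAddMonoidHom A (op q)
  let rC (q : ℍ) : C →+ C := DistribSMul.toAddMonoidHom C (op q)
  f - (rC qi).comp (f.comp (rA qi)) - (rC qj).comp (f.comp (rA qj))
    - (rC qk).comp (f.comp (rA qk))

/-- By `average_right_smul` the four averages recover the real coordinates of `q`. The extension is
defined through averages, so uniqueness of coefficients is not needed. -/
theorem commutantExtension_right_smul (ψ : quaternionCommutant A →+ quaternionCommutant C)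
    (hψ : ∀ (r : ℝ) (a : quaternionCommutant A),
      (ψ ⟨(r : ℍ) • a.1, smul_real_mem r a.2⟩ : C) = (r : ℍ) • (ψ a : C))
    (a : quaternionCommutant A) (q : ℍ) :
    commutantExtension ψ (a.1 <• q) = (ψ a : C) <• q := by
  have h : ∀ p : ℍ, (ψ ⟨average (a.1 <• p), average_mem _⟩ : C) = (ψ a : C) <• (p.re : ℍ) :=
    fun p => by
      rw [← real_smul_eq, ← hψ]
      congr 3
      exact average_right_smul a.2 p
  have e : commutantExtension ψ (a.1 <• q) = (ψ ⟨average (a.1 <• q), average_mem _⟩ : C)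
      - (ψ ⟨average (a.1 <• q <• qi), average_mem _⟩ : C) <• qi
      - (ψ ⟨average (a.1 <• q <• qj), average_mem _⟩ : C) <• qj
      - (ψ ⟨average (a.1 <• q <• qk), average_mem _⟩ : C) <• qk := rfl
  rw [e]
  simp only [smul_smul, ← op_mul, h, ← sub_smul, ← op_sub]
  congr 2
  ext <;> simp

theorem nonempty_quaternionBStarEquiv (hA : ∀ a : A, IsStarNormal a)
    (hC : ∀ c : C, IsStarNormal c) (ψ : quaternionCommutant A →ₙ+* quaternionCommutant C)
    (hsurj : Function.Surjective ψ) (hnorm : ∀ a, ‖(ψ a : C)‖ = ‖(a : A)‖)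
    (hψ : ∀ (r : ℝ) (a : quaternionCommutant A),
      (ψ ⟨(r : ℍ) • a.1, smul_real_mem r a.2⟩ : C) = (r : ℍ) • (ψ a : C)) :
    Nonempty (QuaternionBStarEquiv A C) := by
  obtain ⟨E, hE⟩ : ∃ E : A →+ C, ∀ (a : quaternionCommutant A) (q : ℍ),
      E (a.1 <• q) = (ψ a : C) <• q :=
    ⟨_, commutantExtension_right_smul (ψ : quaternionCommutant A →+ quaternionCommutant C) hψ⟩
  have hmul : ∀ x y, E (x * y) = E x * E y := by
    intro x y
    induction x using induction_right_smul with
    | add x x' hx hx' => rw [add_mul, map_add, map_add, hx, hx', add_mul]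
    | smul a ha p =>
      induction y using induction_right_smul with
      | add y y' hy hy' => rw [mul_add, map_add, map_add, hy, hy', mul_add]
      | smul b hb q =>
        have h := hE (⟨a, ha⟩ * ⟨b, hb⟩) (p * q)
        rw [map_mul] at h
        rw [right_smul_mul_right_smul hb, hE ⟨a, ha⟩, hE ⟨b, hb⟩,
          right_smul_mul_right_smul (ψ ⟨b, hb⟩).2]
        exact h
  have hstar : ∀ x, E (star x) = star (E x) := by
    intro x
    induction x using induction_right_smul with
    | add x y hx hy => rw [star_add, map_add, map_add, hx, hy, star_add]
    | smul a ha q =>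
      rw [star_right_smul_eq hA ha, hE ⟨a, ha⟩, hE ⟨a, ha⟩, star_right_smul_eq hC (ψ ⟨a, ha⟩).2]
  have hleft : ∀ (q : ℍ) x, E (q • x) = q • E x := by
    intro q x
    induction x using induction_right_smul with
    | add x y hx hy => rw [smul_add, map_add, map_add, hx, hy, smul_add]
    | smul a ha p =>
      rw [left_smul_right_smul ha, hE ⟨a, ha⟩, hE ⟨a, ha⟩, left_smul_right_smul (ψ ⟨a, ha⟩).2]
  have hright : ∀ x (q : ℍ), E (x <• q) = E x <• q := by
    intro x q
    induction x using induction_right_smul with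
    | add x y hx hy => rw [smul_add, map_add, map_add, hx, hy, smul_add]
    | smul a ha p =>
      rw [smul_smul, ← op_mul, hE ⟨a, ha⟩, hE ⟨a, ha⟩, smul_smul, ← op_mul]
  have hE1 : ∀ a : quaternionCommutant A, E a = (ψ a : C) := fun a => by
    simpa using hE a 1
  have hEnorm : ∀ x, ‖E x‖ = ‖x‖ := by
    intro x
    have hx : star x * x ∈ quaternionCommutant A :=
      (mem_quaternionCommutant_iff_star_eq hA).2 (by rw [star_mul, star_star])
    rw [← mul_self_inj (norm_nonneg _) (norm_nonneg _), ← CStarRing.norm_star_mul_self,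
      ← CStarRing.norm_star_mul_self, ← hstar, ← hmul, hE1 ⟨_, hx⟩, hnorm]
  have hbij : Function.Bijective E := by
    refine ⟨(injective_iff_map_eq_zero E).2 fun x hx => ?_, fun c => ?_⟩
    · rw [← norm_eq_zero, ← hEnorm, hx, norm_zero]
    · change c ∈ E.range
      induction c using induction_right_smul with
      | add x y hx hy => exact add_mem hx hy
      | smul c hc q =>
        obtain ⟨a, ha⟩ := hsurj ⟨c, hc⟩
        exact ⟨a.1 <• q, by rw [hE, ha]⟩
  exact ⟨{
    Equiv.ofBijective E hbij with
    map_mul' := hmul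
    map_add' := map_add E
    map_star' := hstar
    map_left_smul := hleft
    map_right_smul := hright
    norm_map := hEnorm }⟩

end Extension

theorem isStarNormal_zeroAtInfty {Ω : Type*} [TopologicalSpace Ω] (f : C₀(Ω, ℍ)) :
    IsStarNormal f := ⟨by
  ext1 x
  change star (f x) * f x = f x * star (f x)
  rw [Quaternion.star_mul_self, Quaternion.self_mul_star]⟩

/-! ### Real functions inside `C₀(Ω, ℂ)` and `C₀(Ω, ℍ)` -/

section ZeroAtInfty

open Filter Topology

variable {Ω : Type*} [TopologicalSpace Ω]

theorem continuous_coeComplex : Continuous (fun z : ℂ => (z : ℍ)) :=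
  (AddMonoidHomClass.isometry_of_norm Quaternion.ofComplex norm_coeComplex).continuous

/-- The inclusion of complex-valued into quaternion-valued functions. -/
noncomputable def ofComplexZeroAtInfty : C₀(Ω, ℂ) →ₙ+* C₀(Ω, ℍ) where
  toFun f :=
    { toFun := fun x => (f x : ℍ)
      continuous_toFun := continuous_coeComplex.comp f.continuous
      zero_at_infty' := by
        have h := (continuous_coeComplex.tendsto 0).comp f.zero_at_infty'
        rwa [Quaternion.coeComplex_zero] at h }
  map_mul' f g := by
    ext1 x
    exact Quaternion.coeComplex_mul _ _
  map_zero' := by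
    ext1 x
    exact Quaternion.coeComplex_zero
  map_add' f g := by
    ext1 x
    exact Quaternion.coeComplex_add _ _

theorem norm_ofComplexZeroAtInfty (f : C₀(Ω, ℂ)) : ‖ofComplexZeroAtInfty f‖ = ‖f‖ := by
  simp only [← ZeroAtInftyContinuousMap.norm_toBCF_eq_norm,
    BoundedContinuousFunction.norm_eq_iSup_norm]
  exact iSup_congr fun x => norm_coeComplex (f x)

theorem ofComplexZeroAtInfty_mem {f : C₀(Ω, ℂ)} (hf : star f = f) :
    ofComplexZeroAtInfty f ∈ quaternionCommutant C₀(Ω, ℍ) := by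
  refine (mem_quaternionCommutant_iff_star_eq isStarNormal_zeroAtInfty).2 ?_
  ext1 x
  change star (f x : ℍ) = (f x : ℍ)
  rw [star_coeComplex, ← ZeroAtInftyContinuousMap.star_apply, hf]

theorem exists_ofComplexZeroAtInfty_eq {g : C₀(Ω, ℍ)}
    (hg : g ∈ quaternionCommutant C₀(Ω, ℍ)) :
    ∃ f : C₀(Ω, ℂ), star f = f ∧ ofComplexZeroAtInfty f = g := by
  have hre : Continuous fun q : ℍ => (q.re : ℂ) :=
    Complex.continuous_ofReal.comp Quaternion.continuous_re
  -- Self-adjointness makes `g` real-valued, so the real part loses nothing.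
  refine ⟨{ toFun := fun x => ((g x).re : ℂ)
            continuous_toFun := hre.comp g.continuous
            zero_at_infty' := by simpa using! (hre.tendsto 0).comp g.zero_at_infty' }, ?_, ?_⟩
  · ext1 x
    exact Complex.conj_ofReal _
  · ext1 x
    have h : star (g x) = g x := DFunLike.congr_fun
      (star_eq_self_of_mem_quaternionCommutant isStarNormal_zeroAtInfty hg) x
    exact (Quaternion.coeComplex_coe _).trans (Quaternion.star_eq_self.1 h).symm

end ZeroAtInfty

/-- If every element is normal, a realization of the complex commutant as an algebra of functions
extends to the whole algebra. -/
theorem nonempty_quaternionBStarEquiv_zeroAtInfty {A : Type*} [NonUnitalNormedRing A] [StarRing A]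
    [Module ℍ A] [Module ℍᵐᵒᵖ A] [QuaternionBStarAlgebra A] (hA : ∀ a : A, IsStarNormal a)
    {Ω : Type*} [TopologicalSpace Ω] (φ : complexCommutant A ≃⋆ₐ[ℂ] C₀(Ω, ℂ)) :
    Nonempty (QuaternionBStarEquiv A C₀(Ω, ℍ)) := by
  let ι : quaternionCommutant A →ₙ+* complexCommutant A :=
    NonUnitalSubring.inclusion quaternionCommutant_le_complexCommutant
  have hι : ∀ a, star (ι a) = ι a := fun a =>
    Subtype.ext (star_eq_self_of_mem_quaternionCommutant hA a.2)
  have hφι : ∀ a, star (φ (ι a)) = φ (ι a) := fun a => by rw [← map_star, hι]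
  let ψ : quaternionCommutant A →ₙ+* quaternionCommutant C₀(Ω, ℍ) :=
    NonUnitalRingHom.codRestrict
      (ofComplexZeroAtInfty.comp ((φ : complexCommutant A →ₙ+* C₀(Ω, ℂ)).comp ι))
      (quaternionCommutant C₀(Ω, ℍ)) fun a => ofComplexZeroAtInfty_mem (hφι a)
  have hψ : ∀ a, (ψ a : C₀(Ω, ℍ)) = ofComplexZeroAtInfty (φ (ι a)) := fun a => rfl
  refine nonempty_quaternionBStarEquiv hA isStarNormal_zeroAtInfty ψ (fun g => ?_) (fun a => ?_)
    fun r a => ?_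
  · obtain ⟨f, hf, hfg⟩ := exists_ofComplexZeroAtInfty_eq g.2
    obtain ⟨b, rfl⟩ := EquivLike.surjective φ f
    -- Being self-adjoint upgrades `b` from commuting with `ℂ` to commuting with all of `ℍ`.
    have hb : star b.1 = b.1 :=
      congrArg Subtype.val (EquivLike.injective φ ((map_star φ b).trans hf))
    exact ⟨⟨b.1, (mem_quaternionCommutant_iff_star_eq hA).2 hb⟩, Subtype.ext hfg⟩
  · rw [hψ, norm_ofComplexZeroAtInfty, NonUnitalStarAlgHom.norm_map φ (EquivLike.injective φ)]
    rfl
  · have h : ι ⟨(r : ℍ) • a.1, smul_real_mem r a.2⟩ = (r : ℂ) • ι a := Subtype.ext (by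
      rw [coe_complex_smul, Quaternion.coeComplex_coe]
      rfl)
    rw [hψ, hψ, h, map_smul]
    ext1 x
    change (((r : ℂ) * φ (ι a) x : ℂ) : ℍ) = (r : ℍ) * (φ (ι a) x : ℍ)
    rw [Quaternion.coeComplex_mul, Quaternion.coeComplex_coe]

end QuaternionBStarAlgebra

theorem QuaternionBStarEquiv.isStarNormal {A B : Type*}
    [NonUnitalNormedRing A] [StarRing A] [Module ℍ A] [Module ℍᵐᵒᵖ A] [QuaternionBStarAlgebra A]
    [NonUnitalNormedRing B] [StarRing B] [Module ℍ B] [Module ℍᵐᵒᵖ B] [QuaternionBStarAlgebra B]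
    (e : QuaternionBStarEquiv A B) (h : ∀ b : B, IsStarNormal b) (a : A) : IsStarNormal a := by
  refine ⟨EquivLike.injective e.toStarRingEquiv ?_⟩
  rw [map_mul, map_mul, map_star]
  exact (h _).star_comm_self.eq

theorem mainTheorem2 {A : Type u} [NonUnitalNormedRing A] [StarRing A]
    [Module ℍ A] [Module ℍᵐᵒᵖ A] [QuaternionBStarAlgebra A] :
    (∃ (Ω : Type u) (_ : TopologicalSpace Ω) (_ : LocallyCompactSpace Ω) (_ : T2Space Ω),
      Nonempty (QuaternionBStarEquiv A C₀(Ω, ℍ))) ↔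
    ∀ a : A, IsStarNormal a := by
  constructor
  · rintro ⟨Ω, _, _, _, ⟨e⟩⟩
    exact e.isStarNormal QuaternionBStarAlgebra.isStarNormal_zeroAtInfty
  · intro h
    let _ : NonUnitalCommCStarAlgebra (QuaternionBStarAlgebra.complexCommutant A) :=
      { (inferInstance : NonUnitalCStarAlgebra (QuaternionBStarAlgebra.complexCommutant A)) with
        mul_comm := NonUnitalCStarAlgebra.mul_comm_of_forall_isStarNormal
          (QuaternionBStarAlgebra.isStarNormal_complexCommutant h) }
    obtain ⟨Ω, t, hc, h2, ⟨φ⟩⟩ := NonUnitalCommCStarAlgebra.exists_starAlgEquiv_zeroAtInfty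
      (QuaternionBStarAlgebra.complexCommutant A)
    exact ⟨Ω, t, hc, h2, QuaternionBStarAlgebra.nonempty_quaternionBStarEquiv_zeroAtInfty h φ⟩
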